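/- **Model.** A *population* consists of finitely many players. Player $i$ has a stake $s_i\ge 0$, a slot $j_i$ in which it comes online (and stays online), and in each slot $r$ a mining power $h_i(r)$, which is $0$ or a real number $\ge 1$, and is $0$ before slot $j_i$. Each player holds stake or is a miner active from slot $j_i$ on (or both). Stakeholders are online from slot $0$, whereas miners may join later. The total stake and the total power $n_r=\sum_i h_i(r)$ are positive. In slot $r$ player $i$ may ask $\lfloor \sum_{s\le r}h_i(s)\rfloor-\lfloor\sum_{s<r}h_i(s)\rfloor$ `compute` queries to a random oracle with $\kappa$-bit values. Verification queries do not consume mining power. Each player has a private random tape and an ideal signing key, whose signatures ($\kappa$ random bits) everyone can verify. A *protocol* $\Pi$ prescribes, for every security parameter $\kappa$ and population, what an honest player does in each slot in which it is online: from its state, the messages received and the transactions input by the environment it computes, with adaptive oracle queries within its quota, a new state and messages to be diffused. The state determines its confirmed ledger, a finite list of transactions (bit strings). Players may know the whole population, but not who is corrupted. The adversary corrupts a set of players and uses their keys, tapes and pooled query quota arbitrarily. It chooses the transactions input to honest players, sees all honest messages, chooses the order of delivery, and may send arbitrary messages to selected players. A message diffused by an honest player in slot $s$ reaches every honest player by slot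 $s+\Delta$, or in the slot in which that player comes online, if this is later. An attack (a choice, for every $\kappa$, of a population, a corrupted set, an adversary and a number of slots) is *polynomial* if the number of players, the number of slots, the total mining power in each slot, and the adversary's queries, delivered messages and transaction inputs per slot are bounded by a polynomial in $\kappa$. $\Pi$ is *polynomially bounded* if in every polynomial attack the honest players' queries, messages and ledgers in each slot have size bounded by a polynomial in $\kappa$. An execution yields a *robust public transaction ledger* with parameter $u$ if it satisfies both of the following. * *Persistence*: whenever honest players $i,i'$ are online in slots $r_1,r_2$ with $r_1+\Delta<r_2$, the ledger of $i$ at $r_1$ is a prefix of the ledger of $i'$ at $r_2$. * *Liveness*: if all honest online players are given a transaction throughout the slots $r,\dots,r+u$, then at slot $r+u$ it stands in the ledgers of all honest online players, in the same place. For $\gamma\ge 1$, the *security region* $D_\Pi\subseteq[0,1]^2$ is the set of points $(\beta_w,\beta_s)$ for which there is a polynomial $u(\kappa)$ such that, in every polynomial attack in which the corrupted players hold at most a fraction $\beta_w$ of the mining power in every slot and at most a fraction $\beta_s$ of the stake, and in which $n_r\le\gamma n_{r'}$ for all slots $r,r'$, the execution yields a robust public transaction ledger with parameter $u(\kappa)$,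 except with probability negligible in $\kappa$. **Theorem.** Let $\Delta\ge 1$ and $\gamma\ge 1$, and let $\Pi$ be any polynomially bounded protocol executed by miners and stakeholders. If $p_1+p_2\ge 1$ and $q_1+q_2\ge 1$, then the points $(p_1,q_1)$ and $(p_2,q_2)$ cannot both lie in $D_\Pi$. -/

import Mathlib

open MeasureTheory Filter

namespace HybridLedger

/-- Network messages are bit strings. -/
abbrev Msg := List Bool

/-- Transactions are bit strings. -/
abbrev Tx := List Bool

/-- Values of the random oracle, and signatures, are strings of `κ` bits. -/
abbrev Digest (κ : ℕ) := Fin κ → Bool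

/-- Total size (in bits, with one separator per entry) of a list of bit strings. -/
def size (l : List (List Bool)) : ℕ := (l.map fun m => m.length + 1).sum

/-! ### Populations of miners and stakeholders -/

/-- A population of players together with its resources over time.
`power i r` is the mining power of player `i` in slot `r` (in oracle queries per slot),
`stake i` the stake of player `i`, and `join i` the slot in which player `i` comes online.
Every player is a stakeholder or a miner (or both); stakeholders are online from the beginning,
miners may be activated in any slot and their power may vary. -/
structure Config where
  n : ℕ
  power : Fin n → ℕ → ℝ
  stake : Fin n → ℝ
  join : Fin n → ℕ
  power_eq_zero_or : ∀ i r, power i r = 0 ∨ 1 ≤ power i r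
  power_offline : ∀ i r, r < join i → power i r = 0
  stake_nonneg : ∀ i, 0 ≤ stake i
  stake_online : ∀ i, 0 < stake i → join i = 0
  has_resource : ∀ i, 0 < stake i ∨ 0 < power i (join i)
  total_power_pos : ∀ r, 0 < ∑ i, power i r
  total_stake_pos : 0 < ∑ i, stake i

namespace Config

variable (c : Config)

/-- Mining power of all active miners in slot `r`. -/
def totalPower (r : ℕ) : ℝ := ∑ i, c.power i r

/-- The number of `compute` queries player `i` may ask in slot `r`. The accumulated number of
queries is the rounded-down accumulated mining power; a miner of constant integral power `h`
has exactly `h` queries in each slot. -/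
noncomputable def quota (i : Fin c.n) (r : ℕ) : ℕ :=
  ⌊∑ s ∈ Finset.range (r + 1), c.power i s⌋₊ - ⌊∑ s ∈ Finset.range r, c.power i s⌋₊

/-- The total mining power fluctuates at most by the factor `γ`. -/
def IsRespecting (γ : ℝ) : Prop := ∀ r r', c.totalPower r ≤ γ * c.totalPower r'

/-- The players in `S` hold at most a fraction `βw` of the mining power, in every slot, and at most
a fraction `βs` of the stake. -/
def Controls (S : Finset (Fin c.n)) (βw βs : ℝ) : Prop :=
  (∀ r, ∑ i ∈ S, c.power i r ≤ βw * c.totalPower r) ∧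
    ∑ i ∈ S, c.stake i ≤ βs * ∑ i, c.stake i

end Config

/-! ### Randomness and oracles -/

/-- Index set of the independent fair bits of an execution: the bits of the random oracle at `x`,
the bits of the ideal signature of the `i`-th player on `m`, the random tapes of the players, and
the random tape (`tape none`) of the adversary. -/
inductive Coordinate : Type
  | hash (x : List Bool) (k : ℕ)
  | sig (i : ℕ) (m : List Bool) (k : ℕ)
  | tape (o : Option ℕ) (k : ℕ)

/-- An assignment of all random bits. -/
abbrev Coins := Coordinate → Bool

/-- All bits are independent and uniform. -/
noncomputable def coinMeasure : Measure Coins :=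
  Measure.infinitePi fun _ => (PMF.uniformOfFintype Bool).toMeasure

/-- The queries that a party can ask among `n` players: compute or verify a value of the random
oracle, sign as player `i`, verify a signature, read a bit of a random tape. -/
inductive Query (κ n : ℕ) : Type
  | compute (x : List Bool)
  | verify (x : List Bool) (y : Digest κ)
  | sign (i : Fin n) (m : List Bool)
  | verifySig (i : Fin n) (m : List Bool) (y : Digest κ)
  | tape (o : Option (Fin n)) (k : ℕ)

namespace Query

variable {κ n : ℕ}

/-- Type of the answer to a query. -/
def Answer : Query κ n → Type
  | compute _ => Digest κ
  | verify _ _ => Bool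
  | sign _ _ => Digest κ
  | verifySig _ _ _ => Bool
  | tape _ _ => Bool

/-- Only `compute` queries consume mining power. -/
def cost : Query κ n → ℕ
  | compute _ => 1
  | _ => 0

/-- The answer given to a party that owns the identities in `ids` (`some i` for player `i`, `none`
for the adversary): everybody can compute and verify, but signing as `i` and reading the
tape of `i` are reserved to the owner of the identity, others get a constant. -/
def answer (ω : Coins) (ids : Finset (Option (Fin n))) : (q : Query κ n) → q.Answer
  | compute x => fun k : Fin κ => ω (.hash x k)
  | verify x y => decide ((fun k : Fin κ => ω (.hash x k)) = y)
  | sign i m => fun k : Fin κ => if some i ∈ ids then ω (.sig i m k) else false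
  | verifySig i m y => decide ((fun k : Fin κ => ω (.sig i m k)) = y)
  | tape o k => if o ∈ ids then ω (.tape (o.map fun i => (i : ℕ)) k) else false

end Query

/-- Computations with adaptive oracle queries and a result in `α`. -/
inductive OracleComp (κ n : ℕ) (α : Type) : Type
  | done (a : α)
  | ask (q : Query κ n) (next : q.Answer → OracleComp κ n α)

namespace OracleComp

variable {κ n : ℕ} {α : Type}

/-- The result of the computation. -/
def run (ω : Coins) (ids : Finset (Option (Fin n))) : OracleComp κ n α → α
  | done a => a
  | ask q next => (next (q.answer ω ids)).run ω ids

/-- The number of queries, of any kind, that the computation asks. -/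
def numQueries (ω : Coins) (ids : Finset (Option (Fin n))) : OracleComp κ n α → ℕ
  | done _ => 0
  | ask q next => (next (q.answer ω ids)).numQueries ω ids + 1

/-- On no path does the computation ask more than `b` queries of type `compute`. -/
def ComputeBounded : OracleComp κ n α → ℕ → Prop
  | done _, _ => True
  | ask q next, b => q.cost ≤ b ∧ ∀ a, (next a).ComputeBounded (b - q.cost)

end OracleComp

/-! ### Protocols, adversaries and executions -/

/-- A protocol for miners and stakeholders. All players know the security parameter `κ` and the
population `c` with all its resources (but not who is corrupted). In each slot in which it is online
a player processes the messages received and the transactions input by the environment, and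
diffuses messages. `ledger` is the confirmed ledger of a player. -/
structure Protocol where
  State : Type
  init : (κ : ℕ) → (c : Config) → Fin c.n → State
  step : (κ : ℕ) → (c : Config) → (i : Fin c.n) → (r : ℕ) → State →
    (inbox : List Msg) → (input : List Tx) → OracleComp κ c.n (State × List Msg)
  ledger : State → List Tx
  computeBounded : ∀ κ c i r st inbox input,
    (step κ c i r st inbox input).ComputeBounded (c.quota i r)

/-- What the adversary, who also plays the environment, decides in a slot: the messages delivered
to each player, in their order, and the transactions input to each player. -/
structure Move (n : ℕ) where
  deliver : Fin n → List Msg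
  input : Fin n → List Tx

/-- An adversary that has corrupted the set `S` of players. At the beginning of slot `r` it learns
the messages that honest players diffused in the previous slot, computes with the identities
and the pooled `compute` queries of the corrupted players, and makes its move. -/
structure Adversary (κ : ℕ) (c : Config) (S : Finset (Fin c.n)) where
  State : Type
  init : State
  step : (r : ℕ) → State → (observed : Fin c.n → List Msg) →
    OracleComp κ c.n (State × Move c.n)
  computeBounded : ∀ r st observed,
    (step r st observed).ComputeBounded (∑ i ∈ S, c.quota i r)

/-- A population, a set of corrupted players, an adversary, and a number of slots. -/
structure Attack (κ : ℕ) where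
  config : Config
  corrupted : Finset (Fin config.n)
  adversary : Adversary κ config corrupted
  horizon : ℕ

/-- Global state: states of the players, messages diffused by each honest player in each past slot,
state of the adversary. -/
structure World (P : Protocol) {κ : ℕ} (A : Attack κ) where
  st : Fin A.config.n → P.State
  sent : ℕ → Fin A.config.n → List Msg
  adv : A.adversary.State

namespace World

variable {P : Protocol} {κ : ℕ} {A : Attack κ}

/-- The honest messages that have to reach player `j` in slot `r` at the latest: those diffused
exactly `Δ` slots ago, and, when `j` comes online, all those diffused at least `Δ` slots ago. -/
def due (Δ : ℕ) (w : World P A) (j : Fin A.config.n) (r : ℕ) : List Msg :=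
  ((List.range (r + 1)).filter fun s =>
      decide (s + Δ = r ∨ (A.config.join j = r ∧ s + Δ ≤ r))).flatMap fun s =>
    (List.finRange A.config.n).flatMap fun i => w.sent s i

/-- The computation of the adversary in slot `r`. -/
def advComp (w : World P A) (r : ℕ) :
    OracleComp κ A.config.n (A.adversary.State × Move A.config.n) :=
  A.adversary.step r w.adv (w.sent (r - 1))

/-- New state and move of the adversary in slot `r`. -/
def advRes (ω : Coins) (w : World P A) (r : ℕ) : A.adversary.State × Move A.config.n :=
  (w.advComp r).run ω (Finset.insertNone A.corrupted)

/-- The messages received by player `j` in slot `r`: those delivered by the adversary, and the due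
honest messages that the adversary left out. -/
def inbox (Δ : ℕ) (ω : Coins) (w : World P A) (j : Fin A.config.n) (r : ℕ) : List Msg :=
  (w.advRes ω r).2.deliver j ++
    (w.due Δ j r).filter fun m => decide (m ∉ (w.advRes ω r).2.deliver j)

/-- The computation of the honest player `j` in slot `r`. -/
def comp (Δ : ℕ) (ω : Coins) (w : World P A) (j : Fin A.config.n) (r : ℕ) :
    OracleComp κ A.config.n (P.State × List Msg) :=
  P.step κ A.config j r (w.st j) (w.inbox Δ ω j r) ((w.advRes ω r).2.input j)

/-- New state and diffused messages of player `j` in slot `r`, if it is honest and online. -/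
def res (Δ : ℕ) (ω : Coins) (w : World P A) (j : Fin A.config.n) (r : ℕ) : P.State × List Msg :=
  if j ∉ A.corrupted ∧ A.config.join j ≤ r then (w.comp Δ ω j r).run ω {some j} else (w.st j, [])

/-- One slot of the execution. -/
def next (Δ : ℕ) (ω : Coins) (w : World P A) (r : ℕ) : World P A where
  st j := (w.res Δ ω j r).1
  sent := Function.update w.sent r fun j => (w.res Δ ω j r).2
  adv := (w.advRes ω r).1

end World

section Execution

variable (P : Protocol) (Δ : ℕ) {κ : ℕ} (A : Attack κ) (ω : Coins)

/-- The execution: `exec r` is the global state at the beginning of slot `r`. -/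
def exec : ℕ → World P A
  | 0 => { st := P.init κ A.config, sent := fun _ _ => [], adv := A.adversary.init }
  | r + 1 => (exec r).next Δ ω r

/-- The move of the adversary in slot `r`. -/
def move (r : ℕ) : Move A.config.n := ((exec P Δ A ω r).advRes ω r).2

/-- The confirmed ledger of player `i` at the end of slot `r`. -/
def ledgerAt (i : Fin A.config.n) (r : ℕ) : List Tx := P.ledger ((exec P Δ A ω (r + 1)).st i)

/-- Player `i` is an honest player that is online in slot `r`. -/
def IsHonest (i : Fin A.config.n) (r : ℕ) : Prop := i ∉ A.corrupted ∧ A.config.join i ≤ r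

/-- Persistence. -/
def Persistence : Prop :=
  ∀ i j r₁ r₂, r₁ < A.horizon → r₂ < A.horizon → IsHonest A i r₁ → IsHonest A j r₂ →
    r₁ + Δ < r₂ → ledgerAt P Δ A ω i r₁ <+: ledgerAt P Δ A ω j r₂

/-- Liveness with parameter `u`: a transaction which all honest online players are given throughout
more than `u` slots is, at the end of these slots, in the ledgers of all honest online
players, in the same place. -/
def Liveness (u : ℕ) : Prop :=
  ∀ (tx : Tx) (r : ℕ), r + u < A.horizon →
    (∀ s, r ≤ s → s ≤ r + u → ∀ i, IsHonest A i s → tx ∈ (move P Δ A ω s).input i) →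
    ∃ k : ℕ, ∀ i, IsHonest A i (r + u) → (ledgerAt P Δ A ω i (r + u))[k]? = some tx

/-- The execution yields a robust public transaction ledger. -/
def Robust (u : ℕ) : Prop := Persistence P Δ A ω ∧ Liveness P Δ A ω u

end Execution

/-! ### Polynomial bounds and the security region -/

/-- The population, the number of slots, and the queries, messages and inputs of the adversary are
polynomially bounded in the security parameter. -/
def AttackPolyBounded (P : Protocol) (Δ : ℕ) (A : ∀ κ, Attack κ) : Prop :=
  ∃ B : Polynomial ℕ, ∀ κ,
    (A κ).horizon ≤ B.eval κ ∧ (A κ).config.n ≤ B.eval κ ∧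
    ∀ r < (A κ).horizon, (A κ).config.totalPower r ≤ (B.eval κ : ℕ) ∧ ∀ ω,
      ((exec P Δ (A κ) ω r).advComp r).numQueries ω (Finset.insertNone (A κ).corrupted)
        ≤ B.eval κ ∧
      ∀ j, size ((move P Δ (A κ) ω r).deliver j) ≤ B.eval κ ∧
        size ((move P Δ (A κ) ω r).input j) ≤ B.eval κ

/-- The protocol is efficient: against polynomially bounded attacks, the queries, the messages and
the ledgers of the honest players are polynomially bounded in the security parameter. -/
def Protocol.PolyBounded (P : Protocol) (Δ : ℕ) : Prop :=
  ∀ A : ∀ κ, Attack κ, AttackPolyBounded P Δ A →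
    ∃ B : Polynomial ℕ, ∀ κ ω, ∀ r < (A κ).horizon, ∀ i, IsHonest (A κ) i r →
      ((exec P Δ (A κ) ω r).comp Δ ω i r).numQueries ω {some i} ≤ B.eval κ ∧
      size ((exec P Δ (A κ) ω (r + 1)).sent r i) ≤ B.eval κ ∧
      size (ledgerAt P Δ (A κ) ω i r) ≤ B.eval κ

/-- With polynomial liveness parameter `u`, the protocol generates a robust public transaction
ledger, except with negligible probability, under every polynomially bounded adversary that controls
at most a fraction `βw` of the mining power and at most a fraction `βs` of the stake. -/
def SecureAt (P : Protocol) (Δ : ℕ) (γ βw βs : ℝ) : Prop :=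
  ∃ u : Polynomial ℕ, ∀ A : ∀ κ, Attack κ, AttackPolyBounded P Δ A →
    (∀ κ, (A κ).config.IsRespecting γ) →
    (∀ κ, (A κ).config.Controls (A κ).corrupted βw βs) →
    Asymptotics.SuperpolynomialDecay atTop (fun κ : ℕ => (κ : ℝ)) fun κ =>
      coinMeasure.real {ω | ¬ Robust P Δ (A κ) ω (u.eval κ)}

/-- The security region of the protocol, in networks with delay at most `Δ` and populations whose
total mining power fluctuates at most by the factor `γ`. -/
def securityRegion (P : Protocol) (Δ : ℕ) (γ : ℝ) : Set (ℝ × ℝ) :=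
  {x | x ∈ Set.Icc (0 : ℝ) 1 ×ˢ Set.Icc (0 : ℝ) 1 ∧ SecureAt P Δ γ x.1 x.2}

end HybridLedger

/-! The argument is a partition attack with an indistinguishable late joiner. Player `a` gets the
fractions `p₁` of power and `q₁` of stake, player `b` the rest, and a miner `l` comes online in a
slot `R` beyond both liveness parameters plus `Δ`. In one scenario `a` is corrupted and simulates an
honest player without contact to others, while `b` really is alone; in the other scenario the roles
are exchanged. In slot `R` all messages of both are handed to `l` in a canonical order. For the same
coins, `l` computes the same ledger in both scenarios (`Trio.ledgerAt_splitAttack`).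

If both executions are robust, liveness puts the transaction of `b` into the ledger of the solitary
`b`, and persistence makes that ledger a prefix of the ledger of `l`; the same holds for `a`
(`Trio.ledger_of_robust`). Two prefixes of one list are comparable, so one solitary player has the
transaction given only to the other. A solitary ledger has polynomial size and is computed from the
player's own transaction, so averaging over all `κ`-bit transactions yields a fixed pair for which
this has probability at most polynomial over `2 ^ κ` (`exists_measureReal_mem_add_le`). Hence the
two failure probabilities cannot both tend to `0`. -/

namespace HybridLedger

open Topology

/-! ### Simulating honest players, and local constancy of computations in the coins -/

namespace OracleComp

variable {κ n : ℕ} {α β : Type}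

/-- The computation of an honest player, executed as a part of the computation of an adversary: the
tape of the adversary, which the player cannot read, is replaced by a constant. -/
def simulate (f : α → β) : OracleComp κ n α → OracleComp κ n β
  | done a => done (f a)
  | ask (.tape none _) next => (next false).simulate f
  | ask (.tape (some i) k) next => ask (.tape (some i) k) fun a => (next a).simulate f
  | ask (.compute x) next => ask (.compute x) fun a => (next a).simulate f
  | ask (.verify x y) next => ask (.verify x y) fun a => (next a).simulate f
  | ask (.sign i m) next => ask (.sign i m) fun a => (next a).simulate f
  | ask (.verifySig i m y) next => ask (.verifySig i m y) fun a => (next a).simulate f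

/-- The identity sets of the adversary and of the honest player differ only in `none`, which affects
only the query `tape none`; there the honest player reads the constant `false`. -/
theorem run_simulate (f : α → β) (a : Fin n) (ω : Coins) (C : OracleComp κ n α) :
    (C.simulate f).run ω (Finset.insertNone {a}) = f (C.run ω {some a}) := by
  induction C with
  | done => rfl
  | ask q next ih =>
    rcases q with x | ⟨x, y⟩ | ⟨i, m⟩ | ⟨i, m, y⟩ | ⟨_ | i, k⟩ <;>
      simpa [simulate, run, Query.answer] using ih _

theorem numQueries_simulate_le (f : α → β) (a : Fin n) (ω : Coins) (C : OracleComp κ n α) :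
    (C.simulate f).numQueries ω (Finset.insertNone {a}) ≤ C.numQueries ω {some a} := by
  induction C with
  | done => exact le_rfl
  | ask q next ih =>
    rcases q with x | ⟨x, y⟩ | ⟨i, m⟩ | ⟨i, m, y⟩ | ⟨_ | i, k⟩
    case tape.none =>
      simpa [simulate, numQueries, Query.answer] using (ih false).trans (Nat.le_succ _)
    all_goals
      simpa [simulate, numQueries, Query.answer] using ih _

theorem ComputeBounded.simulate (f : α → β) {C : OracleComp κ n α} {b : ℕ}
    (h : C.ComputeBounded b) : (C.simulate f).ComputeBounded b := by
  induction C generalizing b with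
  | done => trivial
  | ask q next ih =>
    rcases q with x | ⟨x, y⟩ | ⟨i, m⟩ | ⟨i, m, y⟩ | ⟨_ | i, k⟩
    case tape.none => exact ih false (by simpa [Query.cost] using h.2 false)
    all_goals exact ⟨h.1, fun a => ih a (h.2 a)⟩

/-- An answer reads at most finitely many coordinates, and bits are discrete. Local constancy serves
later to obtain measurability. -/
theorem eventually_answer_eq (q : Query κ n) (ids : Finset (Option (Fin n))) (ω : Coins) :
    ∀ᶠ ω' in 𝓝 ω, q.answer ω' ids = q.answer ω ids := by
  have key : ∀ x : Coordinate, ∀ᶠ ω' : Coins in 𝓝 ω, ω' x = ω x := fun x =>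
    ((continuous_apply x).tendsto ω).eventually (p := fun v => v = ω x)
      (by rw [nhds_discrete]; exact rfl)
  have keys : ∀ x : Fin κ → Coordinate, ∀ᶠ ω' : Coins in 𝓝 ω, ∀ k, ω' (x k) = ω (x k) :=
    fun x => eventually_all.2 fun k => key (x k)
  rcases q with x | ⟨x, y⟩ | ⟨i, m⟩ | ⟨i, m, y⟩ | ⟨o, k⟩
  · filter_upwards [keys fun k => .hash x k] with ω' h
    simp only [Query.answer, h]
    rfl
  · filter_upwards [keys fun k => .hash x k] with ω' h
    simp only [Query.answer, h]
    rfl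
  · filter_upwards [keys fun k => .sig i m k] with ω' h
    simp only [Query.answer, h]
    rfl
  · filter_upwards [keys fun k => .sig i m k] with ω' h
    simp only [Query.answer, h]
    rfl
  · filter_upwards [key (.tape (o.map fun i => (i : ℕ)) k)] with ω' h
    simp only [Query.answer, h]

/-- The result of a computation depends on finitely many random bits only. -/
theorem eventually_run_eq (C : OracleComp κ n α) (ids : Finset (Option (Fin n))) (ω : Coins) :
    ∀ᶠ ω' in 𝓝 ω, C.run ω' ids = C.run ω ids := by
  induction C with
  | done => exact .of_forall fun _ => rfl
  | ask q next ih =>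
    filter_upwards [eventually_answer_eq q ids ω, ih (q.answer ω ids)] with ω' h₁ h₂
    rw [run, run, h₁, h₂]

end OracleComp

/-! ### Players without contact to others -/

section Solo

variable (P : Protocol) (Δ κ : ℕ) (c : Config) (i : Fin c.n) (t : Tx) (ω : Coins)

/-- The messages that a player without any contact to others receives in slot `r`: those that it
diffused itself `Δ` slots ago. -/
def ownDue (sent : ℕ → List Msg) (r : ℕ) : List Msg :=
  ((List.range (r + 1)).filter fun s => decide (s + Δ = r)).flatMap sent

/-- State and diffused messages, at the beginning of slot `r`, of an honest player that is given the
transaction `t` in every slot and has no contact to others. -/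
def solo : ℕ → P.State × (ℕ → List Msg)
  | 0 => (P.init κ c i, fun _ => [])
  | r + 1 =>
    let res := (P.step κ c i r (solo r).1 (ownDue Δ (solo r).2 r) [t]).run ω {some i}
    (res.1, Function.update (solo r).2 r res.2)

theorem solo_sent_of_lt {r s : ℕ} (h : s < r) :
    (solo P Δ κ c i t ω r).2 s = (solo P Δ κ c i t ω (s + 1)).2 s := by
  induction r, h using Nat.le_induction with
  | base => rfl
  | succ r hr ih =>
    rw [solo]
    simpa [Function.update_of_ne (by omega : s ≠ r)] using ih

theorem eventually_solo_eq (r : ℕ) :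
    ∀ᶠ ω' in 𝓝 ω, solo P Δ κ c i t ω' r = solo P Δ κ c i t ω r := by
  induction r with
  | zero => exact .of_forall fun _ => rfl
  | succ r ih =>
    filter_upwards [ih, OracleComp.eventually_run_eq
      (P.step κ c i r (solo P Δ κ c i t ω r).1 (ownDue Δ (solo P Δ κ c i t ω r).2 r) [t])
      {some i} ω] with ω' h₁ h₂
    simp only [solo, h₁, h₂]

end Solo

/-! ### An isolated player in an execution behaves like `solo` -/

section Isolated

theorem flatMap_finRange_eq {n : ℕ} {f : Fin n → List Msg} (b : Fin n)
    (h : ∀ j, j ≠ b → f j = []) : (List.finRange n).flatMap f = f b := by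
  have key : ∀ l : List (Fin n), l.Nodup → l.flatMap f = if b ∈ l then f b else [] := by
    intro l
    induction l with
    | nil => simp
    | cons j l ih =>
      intro hl
      rw [List.nodup_cons] at hl
      rw [List.flatMap_cons, ih hl.2]
      by_cases hj : j = b
      · subst hj; simp [hl.1]
      · simp [h j hj, Ne.symm hj]
  simpa using key _ (List.nodup_finRange n)

variable (P : Protocol) (Δ : ℕ) {κ : ℕ} (A : Attack κ) (ω : Coins)

theorem exec_st_of_le_join (j : Fin A.config.n) {r : ℕ} (h : r ≤ A.config.join j) :
    (exec P Δ A ω r).st j = P.init κ A.config j := by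
  induction r with
  | zero => rfl
  | succ r ih =>
    have hr : ¬ (j ∉ A.corrupted ∧ A.config.join j ≤ r) := fun h' => by omega
    simp only [exec, World.next, World.res, if_neg hr]
    exact ih (by omega)

/-- Up to slot `R`, player `b` is the only honest player online, it is given the transaction `t` in
each slot and receives nothing from the adversary. -/
structure Isolated (b : Fin A.config.n) (t : Tx) (R : ℕ) : Prop where
  honest : b ∉ A.corrupted
  join_eq : A.config.join b = 0
  alone : ∀ j, j ≠ b → j ∈ A.corrupted ∨ R ≤ A.config.join j
  deliver : ∀ (w : World P A) r, (w.advRes ω r).2.deliver b = []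
  input : ∀ (w : World P A) r, (w.advRes ω r).2.input b = [t]

namespace Isolated

variable {P Δ A ω} {b : Fin A.config.n} {t : Tx} {R : ℕ} (h : Isolated P A ω b t R)
include h

theorem inbox_eq (hΔ : 1 ≤ Δ) (w : World P A) (r : ℕ) (hs : ∀ s j, j ≠ b → w.sent s j = []) :
    w.inbox Δ ω b r = ownDue Δ (fun s => w.sent s b) r := by
  have hd : w.due Δ b r = ownDue Δ (fun s => w.sent s b) r := by
    have h₁ : (fun s => decide (s + Δ = r ∨ A.config.join b = r ∧ s + Δ ≤ r)) =
        fun s => decide (s + Δ = r) := by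
      funext s
      rw [h.join_eq]
      -- The catch-up clause applies only in slot `0`, where `s + Δ ≤ 0` contradicts `1 ≤ Δ`.
      exact decide_eq_decide.2 ⟨fun h => by omega, Or.inl⟩
    have h₂ : (fun s => (List.finRange A.config.n).flatMap fun i => w.sent s i) =
        fun s => w.sent s b := funext fun s => flatMap_finRange_eq b (hs s)
    rw [World.due, ownDue, h₁, h₂]
  rw [World.inbox, h.deliver, hd]
  simp

/-- The third conjunct keeps the induction going: as nobody else has diffused anything, the due
messages are the player's own. -/
theorem exec_eq (hΔ : 1 ≤ Δ) {r : ℕ} (hr : r ≤ R) :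
    (exec P Δ A ω r).st b = (solo P Δ κ A.config b t ω r).1 ∧
      (fun s => (exec P Δ A ω r).sent s b) = (solo P Δ κ A.config b t ω r).2 ∧
      ∀ s j, j ≠ b → (exec P Δ A ω r).sent s j = [] := by
  induction r with
  | zero => exact ⟨rfl, rfl, fun _ _ _ => rfl⟩
  | succ r ih =>
    obtain ⟨h₁, h₂, h₃⟩ := ih (by omega)
    have hres : (exec P Δ A ω r).res Δ ω b r =
        (P.step κ A.config b r (solo P Δ κ A.config b t ω r).1
          (ownDue Δ (solo P Δ κ A.config b t ω r).2 r) [t]).run ω {some b} := by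
      rw [World.res, if_pos ⟨h.honest, by simp [h.join_eq]⟩, World.comp, h.inbox_eq hΔ _ _ h₃,
        h.input, h₁, h₂]
    refine ⟨?_, ?_, fun s j hj => ?_⟩
    · simp only [exec, World.next, hres, solo]
    · simp only [exec, World.next, solo]
      funext s
      by_cases hs : s = r
      · subst hs; simp [hres]
      · simpa [hs] using congrFun h₂ s
    · simp only [exec, World.next]
      by_cases hs : s = r
      · subst hs
        have : ¬ (j ∉ A.corrupted ∧ A.config.join j ≤ s) := fun h' =>
          (h.alone j hj).elim h'.1 fun h'' => by omega
        simp [World.res, if_neg this]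
      · simpa [hs] using h₃ s j hj

theorem comp_eq (hΔ : 1 ≤ Δ) {r : ℕ} (hr : r ≤ R) :
    (exec P Δ A ω r).comp Δ ω b r = P.step κ A.config b r (solo P Δ κ A.config b t ω r).1
      (ownDue Δ (solo P Δ κ A.config b t ω r).2 r) [t] := by
  obtain ⟨h₁, h₂, h₃⟩ := h.exec_eq hΔ hr
  rw [World.comp, h.inbox_eq hΔ _ _ h₃, h.input, h₁, h₂]

theorem ledgerAt_eq (hΔ : 1 ≤ Δ) {r : ℕ} (hr : r < R) :
    ledgerAt P Δ A ω b r = P.ledger (solo P Δ κ A.config b t ω (r + 1)).1 := by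
  rw [ledgerAt, (h.exec_eq hΔ (Nat.succ_le_of_lt hr)).1]

theorem isHonest (r : ℕ) : IsHonest A b r := ⟨h.honest, by simp [h.join_eq]⟩

end Isolated

end Isolated

theorem size_append (l₁ l₂ : List (List Bool)) : size (l₁ ++ l₂) = size l₁ + size l₂ := by
  simp [size]

theorem length_le_size (l : List (List Bool)) : l.length ≤ size l := by
  induction l with
  | nil => simp
  | cons m l ih => simp only [size, List.map_cons, List.sum_cons, List.length_cons] at *; omega

theorem size_flatMap_le {α : Type*} {l : List α} {f : α → List (List Bool)} {B : ℕ}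
    (h : ∀ x ∈ l, size (f x) ≤ B) : size (l.flatMap f) ≤ l.length * B := by
  induction l with
  | nil => simp [size]
  | cons x l ih =>
    rw [List.flatMap_cons, size_append, List.length_cons, Nat.succ_mul, add_comm]
    exact Nat.add_le_add (ih fun y hy => h y (List.mem_cons_of_mem _ hy)) (h x List.mem_cons_self)

/-- The population consists of players `a` and `b`, which are online from the beginning, and of
player `l`. -/
structure Trio (c : Config) (a b l : Fin c.n) : Prop where
  ne : a ≠ b
  ne_left : a ≠ l
  ne_right : b ≠ l
  cover : ∀ j, j = a ∨ j = b ∨ j = l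
  join_left : c.join a = 0
  join_right : c.join b = 0

theorem Trio.symm {c : Config} {a b l : Fin c.n} (h : Trio c a b l) : Trio c b a l :=
  ⟨h.ne.symm, h.ne_right, h.ne_left, fun j => by have := h.cover j; tauto, h.join_right,
    h.join_left⟩

/-! ### The split attack and the view of the late player -/

section Attacks

variable (P : Protocol) (Δ κ : ℕ) (c : Config) (a b l : Fin c.n) (tx : Fin c.n → Tx)

/-- The adversary that corrupts `a`, gives the transactions `tx` to the players, and is silent. -/
abbrev silentAttack : Attack κ where
  config := c
  corrupted := {a}
  adversary :=
    { State := Unit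
      init := ()
      step := fun _ _ _ => .done ((), ⟨fun _ => [], fun j => [tx j]⟩)
      computeBounded := fun _ _ _ => trivial }
  horizon := c.join l + 1

/-- The messages diffused so far, by player `a` according to `old`, by the other players according to
`old` and to the observation `new` of slot `r - 1`. -/
def record (r : ℕ) (old : ℕ → Fin c.n → List Msg) (new : Fin c.n → List Msg) (s : ℕ)
    (j : Fin c.n) : List Msg :=
  if j = a then old s a else if s = r - 1 then new j else old s j

/-- All messages of the slots before `r` in the order of the slots and players. -/
def bundle (r : ℕ) (log : ℕ → Fin c.n → List Msg) : List Msg :=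
  (List.range r).flatMap fun s => (List.finRange c.n).flatMap (log s)

/-- The adversary that corrupts `a` simulates an honest player `a` that has no contact to others, and
delivers nothing until player `l` comes online; then it delivers all messages of the
simulated player and of the other players to `l`. -/
abbrev splitAttack : Attack κ where
  config := c
  corrupted := {a}
  adversary :=
    { State := P.State × (ℕ → Fin c.n → List Msg)
      init := (P.init κ c a, fun _ _ => [])
      step := fun r st obs =>
        (P.step κ c a r st.1 (ownDue Δ (fun s => record c a r st.2 obs s a) r) [tx a]).simulate
          fun res =>
            ((res.1, fun s j => if s = r ∧ j = a then res.2 else record c a r st.2 obs s j),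
              ⟨fun j => if j = l ∧ r = c.join l then bundle c r (record c a r st.2 obs) else [],
                fun j => [tx j]⟩)
      -- The pooled quota of `{a}` is the quota of `a`, within which an honest step of `a` stays.
      computeBounded := fun r st obs => by
        simpa using (P.computeBounded κ c a r st.1 _ [tx a]).simulate _ }
  horizon := c.join l + 1

/-- The messages, before slot `r`, of the players other than `l` without contact to each other. -/
def jointLog (ω : Coins) (r s : ℕ) (j : Fin c.n) : List Msg :=
  if j = l then [] else (solo P Δ κ c j (tx j) ω r).2 s

variable {P Δ κ c a b l tx}

theorem Trio.isolated_silentAttack (h : Trio c a b l) (ω : Coins) :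
    Isolated P (silentAttack κ c a l tx) ω b (tx b) (c.join l) where
  honest := fun hb => h.ne.symm (Finset.mem_singleton.1 hb)
  join_eq := h.join_right
  alone j hj := by
    rcases h.cover j with hj' | hj' | hj'
    · exact .inl (Finset.mem_singleton.2 hj')
    · exact absurd hj' hj
    · exact .inr (congrArg c.join hj').ge
  deliver _ _ := rfl
  input _ _ := rfl

theorem splitAttack_advRes (ω : Coins) (w : World P (splitAttack P Δ κ c a l tx)) (r : ℕ) :
    w.advRes ω r =
      let log := record c a r w.adv.2 (w.sent (r - 1))
      let res := (P.step κ c a r w.adv.1 (ownDue Δ (fun s => log s a) r) [tx a]).run ω {some a}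
      ((res.1, fun s j => if s = r ∧ j = a then res.2 else log s j),
        ⟨fun j => if j = l ∧ r = c.join l then bundle c r log else [], fun j => [tx j]⟩) :=
  OracleComp.run_simulate _ _ _ _

theorem Trio.isolated_splitAttack (h : Trio c a b l) (ω : Coins) :
    Isolated P (splitAttack P Δ κ c a l tx) ω b (tx b) (c.join l) where
  honest := fun hb => h.ne.symm (Finset.mem_singleton.1 hb)
  join_eq := h.join_right
  alone j hj := by
    rcases h.cover j with hj' | hj' | hj'
    · exact .inl (Finset.mem_singleton.2 hj')
    · exact absurd hj' hj
    · exact .inr (congrArg c.join hj').ge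
  deliver w r := by rw [splitAttack_advRes]; exact if_neg fun h' => h.ne_right h'.1
  input w r := by rw [splitAttack_advRes]

/-- The log, once completed by the observation of slot `r - 1`, is an expression that treats `a` and
`b` alike. This symmetry is the source of indistinguishability. -/
theorem Trio.adv_splitAttack (h : Trio c a b l) (hΔ : 1 ≤ Δ) (ω : Coins) {r : ℕ}
    (hr : r ≤ c.join l) :
    (exec P Δ (splitAttack P Δ κ c a l tx) ω r).adv.1 = (solo P Δ κ c a (tx a) ω r).1 ∧
      record c a r (exec P Δ (splitAttack P Δ κ c a l tx) ω r).adv.2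
        ((exec P Δ (splitAttack P Δ κ c a l tx) ω r).sent (r - 1)) =
          jointLog P Δ κ c l tx ω r := by
  have hiso := h.isolated_splitAttack (P := P) (Δ := Δ) (κ := κ) (tx := tx) ω
  induction r with
  | zero =>
    refine ⟨rfl, ?_⟩
    funext s j
    simp [record, exec, jointLog, solo]
  | succ r ih =>
    obtain ⟨h₁, h₂⟩ := ih (by omega)
    have hown : (fun s => jointLog P Δ κ c l tx ω r s a) = (solo P Δ κ c a (tx a) ω r).2 := by
      funext s
      exact if_neg h.ne_left
    obtain ⟨-, hs, hs'⟩ := hiso.exec_eq hΔ hr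
    have hadv : (exec P Δ (splitAttack P Δ κ c a l tx) ω (r + 1)).adv =
        ((solo P Δ κ c a (tx a) ω (r + 1)).1,
          fun s j => if s = r ∧ j = a then (solo P Δ κ c a (tx a) ω (r + 1)).2 r
            else jointLog P Δ κ c l tx ω r s j) := by
      simp only [exec, World.next]
      rw [splitAttack_advRes]
      simp only [h₁, h₂, hown, solo, Function.update_self]
    refine ⟨by rw [hadv], ?_⟩
    funext s j
    rw [hadv]
    simp only [record, Nat.add_sub_cancel]
    have hsolo : ∀ j, s ≠ r →
        (solo P Δ κ c j (tx j) ω r).2 s = (solo P Δ κ c j (tx j) ω (r + 1)).2 s := by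
      intro j hsr
      simp [solo, hsr]
    -- The entry of slot `r` comes from the simulation for `a` and from the observation for `b`; `l`
    -- is not yet online.
    rcases h.cover j with rfl | rfl | rfl
    · by_cases hsr : s = r
      · simp [hsr, jointLog, h.ne_left]
      · simp [hsr, jointLog, h.ne_left, hsolo j hsr]
    · by_cases hsr : s = r
      · subst hsr
        simpa [jointLog, h.ne_right, h.ne.symm] using congrFun hs s
      · simp [hsr, jointLog, h.ne_right, h.ne.symm, hsolo j hsr]
    · by_cases hsr : s = r
      · subst hsr
        simpa [jointLog, h.ne_left.symm] using hs' s j h.ne_right.symm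
      · simp [hsr, jointLog, h.ne_left.symm]

/-- Player `l` cannot distinguish whether `a` or `b` is corrupted. -/
theorem Trio.ledgerAt_splitAttack (h : Trio c a b l) (hΔ : 1 ≤ Δ) (ω : Coins) :
    ledgerAt P Δ (splitAttack P Δ κ c a l tx) ω l (c.join l) =
      P.ledger ((P.step κ c l (c.join l) (P.init κ c l)
        (bundle c (c.join l) (jointLog P Δ κ c l tx ω (c.join l))) [tx l]).run ω {some l}).1 := by
  have hiso := h.isolated_splitAttack (P := P) (Δ := Δ) (κ := κ) (tx := tx) ω
  obtain ⟨h₁, h₂⟩ := h.adv_splitAttack (P := P) (κ := κ) (tx := tx) hΔ ω le_rfl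
  obtain ⟨-, hs, hs'⟩ := hiso.exec_eq hΔ le_rfl
  have hst := exec_st_of_le_join P Δ (splitAttack P Δ κ c a l tx) ω l le_rfl
  change (exec P Δ (splitAttack P Δ κ c a l tx) ω (c.join l)).st l = P.init κ c l at hst
  set w := exec P Δ (splitAttack P Δ κ c a l tx) ω (c.join l) with hw
  have hmove : (w.advRes ω (c.join l)).2.deliver l =
        bundle c (c.join l) (jointLog P Δ κ c l tx ω (c.join l)) ∧
      (w.advRes ω (c.join l)).2.input l = [tx l] := by
    rw [splitAttack_advRes]
    simp [h₂]
  have hinbox : w.inbox Δ ω l (c.join l) =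
      bundle c (c.join l) (jointLog P Δ κ c l tx ω (c.join l)) := by
    -- The due messages stem from `b` and, since `1 ≤ Δ`, from earlier slots. They are already in
    -- the bundle, so nothing is appended that would reveal who is honest.
    rw [World.inbox, hmove.1, List.append_right_eq_self, List.filter_eq_nil_iff]
    intro m hm
    simp only [World.due, List.mem_flatMap, List.mem_filter, List.mem_range, decide_eq_true_eq]
      at hm
    obtain ⟨s, ⟨-, hsR⟩, i, -, hm⟩ := hm
    have hi : i = b := by
      by_contra hi
      rw [hs' s i hi] at hm
      simp at hm
    subst hi
    have hm' : m ∈ (solo P Δ κ c i (tx i) ω (c.join l)).2 s := by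
      rw [← congrFun hs s]; exact hm
    simp only [decide_not, Bool.not_eq_true', decide_eq_false_iff_not, not_not, bundle,
      List.mem_flatMap, List.mem_range, List.mem_finRange, true_and]
    exact ⟨s, by omega, i, by rwa [jointLog, if_neg h.ne_right]⟩
  have hres : w.res Δ ω l (c.join l) = (P.step κ c l (c.join l) (P.init κ c l)
        (bundle c (c.join l) (jointLog P Δ κ c l tx ω (c.join l))) [tx l]).run ω {some l} := by
    have hl : l ∉ (splitAttack P Δ κ c a l tx).corrupted ∧
        (splitAttack P Δ κ c a l tx).config.join l ≤ c.join l :=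
      ⟨fun hb => h.ne_left.symm (Finset.mem_singleton.1 hb), le_rfl⟩
    rw [World.res, if_pos hl, World.comp, hinbox, hmove.2, hst]
  change P.ledger (w.res Δ ω l (c.join l)).1 = _
  rw [hres]

end Attacks

/-- A robust execution of the split attack: the ledger of `l` extends the ledger of the isolated
player, which contains its transaction. -/
theorem Trio.ledger_of_robust {P : Protocol} {Δ κ : ℕ} {c : Config} {a b l : Fin c.n}
    {tx : Fin c.n → Tx} (h : Trio c a b l) (hΔ : 1 ≤ Δ) {ω : Coins} {u : ℕ}
    (hu : u + Δ < c.join l) (hrob : Robust P Δ (splitAttack P Δ κ c a l tx) ω u) :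
    tx b ∈ P.ledger (solo P Δ κ c b (tx b) ω (u + 1)).1 ∧
      P.ledger (solo P Δ κ c b (tx b) ω (u + 1)).1 <+:
        P.ledger ((P.step κ c l (c.join l) (P.init κ c l)
          (bundle c (c.join l) (jointLog P Δ κ c l tx ω (c.join l))) [tx l]).run ω {some l}).1 := by
  have hiso := h.isolated_splitAttack (P := P) (Δ := Δ) (κ := κ) (tx := tx) ω
  have hled := hiso.ledgerAt_eq hΔ (show u < c.join l by omega)
  have hl : IsHonest (splitAttack P Δ κ c a l tx) l (c.join l) :=
    ⟨fun hl => h.ne_left.symm (Finset.mem_singleton.1 hl), le_rfl⟩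
  rw [← h.ledgerAt_splitAttack hΔ ω, ← hled]
  refine ⟨?_, hrob.1 b l u (c.join l) (show u < c.join l + 1 by omega)
    (Nat.lt_succ_self _) (hiso.isHonest u) hl hu⟩
  -- Until slot `u` the only honest player online is `b`, so giving `tx b` to `b` alone meets the
  -- premise of liveness.
  obtain ⟨k, hk⟩ := hrob.2 (tx b) 0 (show 0 + u < c.join l + 1 by omega) fun s _ hs i hi => by
    rcases h.cover i with hi' | hi' | hi'
    · exact absurd (Finset.mem_singleton.2 hi') hi.1
    · rw [hi', move, hiso.input]
      exact List.mem_singleton_self _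
    · have : c.join i ≤ s := hi.2
      rw [hi'] at this
      omega
  have := hk b (hiso.isHonest _)
  rw [Nat.zero_add] at this
  exact List.mem_of_getElem? this

/-! ### Polynomial bounds -/

section Polynomial

/-- The populations, the slots in which `l` comes online, and the transactions are polynomially
bounded. -/
def PolyFamily (c : ℕ → Config) (l : ∀ κ, Fin (c κ).n) (tx : ∀ κ, Fin (c κ).n → Tx) : Prop :=
  ∃ B : Polynomial ℕ, ∀ κ, (c κ).join (l κ) + 1 ≤ B.eval κ ∧ (c κ).n ≤ B.eval κ ∧
    (∀ r, (c κ).totalPower r ≤ (B.eval κ : ℕ)) ∧ ∀ j, (tx κ j).length + 1 ≤ B.eval κ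

variable {P : Protocol} {Δ : ℕ} {c : ℕ → Config} {a b l : ∀ κ, Fin (c κ).n}
  {tx : ∀ κ, Fin (c κ).n → Tx}

theorem PolyFamily.silentAttack (hf : PolyFamily c l tx) :
    AttackPolyBounded P Δ fun κ => silentAttack κ (c κ) (a κ) (l κ) (tx κ) := by
  obtain ⟨B, hB⟩ := hf
  refine ⟨B, fun κ => ?_⟩
  obtain ⟨h₁, h₂, h₃, h₄⟩ := hB κ
  exact ⟨h₁, h₂, fun r _ => ⟨h₃ r, fun ω => ⟨Nat.zero_le _, fun j => ⟨Nat.zero_le _, h₄ j⟩⟩⟩⟩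

/-- Honest players that have no contact to others are polynomially bounded. -/
theorem PolyFamily.exists_solo_le (hf : PolyFamily c l tx) (hP : P.PolyBounded Δ) (hΔ : 1 ≤ Δ)
    (h : ∀ κ, Trio (c κ) (a κ) (b κ) (l κ)) :
    ∃ B : Polynomial ℕ, ∀ κ ω r, r ≤ (c κ).join (l κ) →
      (P.step κ (c κ) (b κ) r (solo P Δ κ (c κ) (b κ) (tx κ (b κ)) ω r).1
        (ownDue Δ (solo P Δ κ (c κ) (b κ) (tx κ (b κ)) ω r).2 r) [tx κ (b κ)]).numQueries ω
          {some (b κ)} ≤ B.eval κ ∧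
      (r < (c κ).join (l κ) →
        size ((solo P Δ κ (c κ) (b κ) (tx κ (b κ)) ω (r + 1)).2 r) ≤ B.eval κ ∧
        size (P.ledger (solo P Δ κ (c κ) (b κ) (tx κ (b κ)) ω (r + 1)).1) ≤ B.eval κ) := by
  -- The silent attack is polynomial without any knowledge of the protocol. Bounding the solitary
  -- player through it avoids circularity when the split attack, which runs that player, is bounded.
  obtain ⟨B, hB⟩ := hP _ (hf.silentAttack (P := P) (Δ := Δ) (a := a))
  refine ⟨B, fun κ ω r hr => ?_⟩
  have hiso := (h κ).isolated_silentAttack (P := P) (κ := κ) (tx := tx κ) ω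
  obtain ⟨h₁, h₂, h₃⟩ := hB κ ω r (Nat.lt_succ_of_le hr) (b κ) (hiso.isHonest r)
  rw [hiso.comp_eq hΔ hr] at h₁
  refine ⟨h₁, fun hr' => ?_⟩
  rw [hiso.ledgerAt_eq hΔ hr'] at h₃
  refine ⟨?_, h₃⟩
  rw [← congrFun (hiso.exec_eq hΔ (Nat.succ_le_of_lt hr')).2.1 r]
  exact h₂

theorem PolyFamily.splitAttack (hf : PolyFamily c l tx) (hP : P.PolyBounded Δ) (hΔ : 1 ≤ Δ)
    (h : ∀ κ, Trio (c κ) (a κ) (b κ) (l κ)) :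
    AttackPolyBounded P Δ fun κ => splitAttack P Δ κ (c κ) (a κ) (l κ) (tx κ) := by
  obtain ⟨Ba, hBa⟩ := hf.exists_solo_le hP hΔ fun κ => (h κ).symm
  obtain ⟨Bb, hBb⟩ := hf.exists_solo_le hP hΔ h
  obtain ⟨B, hB⟩ := hf
  -- `Ba` bounds the queries of the simulation; the product bounds the bundle, by slots times
  -- players times the size of the messages of one player in one slot.
  refine ⟨B + Ba + B * (B * (Ba + Bb)), fun κ => ?_⟩
  obtain ⟨h₁, h₂, h₃, h₄⟩ := hB κ
  have hle : B.eval κ ≤ (B + Ba + B * (B * (Ba + Bb))).eval κ := by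
    simp only [Polynomial.eval_add]; omega
  refine ⟨h₁.trans hle, h₂.trans hle, fun r hr => ⟨(h₃ r).trans (Nat.cast_le.2 hle),
    fun ω => ?_⟩⟩
  have hr' : r ≤ (c κ).join (l κ) := Nat.le_of_lt_succ hr
  obtain ⟨hadv, hrec⟩ := (h κ).adv_splitAttack (P := P) (κ := κ) (tx := tx κ) hΔ ω hr'
  refine ⟨?_, fun j => ?_⟩
  · refine (OracleComp.numQueries_simulate_le _ _ _ _).trans ?_
    have hown : (fun s => jointLog P Δ κ (c κ) (l κ) (tx κ) ω r s (a κ)) =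
        (solo P Δ κ (c κ) (a κ) (tx κ (a κ)) ω r).2 := by
      funext s
      exact if_neg (h κ).ne_left
    rw [hadv, hrec, hown]
    have := (hBa κ ω r hr').1
    simp only [Polynomial.eval_add]
    omega
  · rw [move, splitAttack_advRes]
    refine ⟨?_, (h₄ j).trans hle⟩
    simp only [hrec]
    split_ifs with hj
    · have hlog : ∀ s ∈ List.range r, ∀ i ∈ List.finRange (c κ).n,
          size (jointLog P Δ κ (c κ) (l κ) (tx κ) ω r s i) ≤ Ba.eval κ + Bb.eval κ := by
        intro s hs i _
        rw [List.mem_range] at hs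
        have hs' : s < (c κ).join (l κ) := by omega
        rw [jointLog]
        split_ifs with hi
        · exact Nat.zero_le _
        · rw [solo_sent_of_lt _ _ _ _ _ _ _ hs]
          rcases (h κ).cover i with rfl | rfl | hi'
          · exact ((hBa κ ω s hs'.le).2 hs').1.trans (Nat.le_add_right _ _)
          · exact ((hBb κ ω s hs'.le).2 hs').1.trans (Nat.le_add_left _ _)
          · exact absurd hi' hi
      refine (size_flatMap_le fun s hs => size_flatMap_le (hlog s hs)).trans ?_
      rw [List.length_range, List.length_finRange]
      refine le_trans ?_ (show B.eval κ * (B.eval κ * (Ba.eval κ + Bb.eval κ)) ≤ _ by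
        simp [Polynomial.eval_add, Polynomial.eval_mul])
      gcongr
      omega
    · exact Nat.zero_le _

/-- The polynomial bound on the ledgers of players without contact to others is uniform in their
transactions. -/
theorem exists_ledger_solo_le (hP : P.PolyBounded Δ) (hΔ : 1 ≤ Δ)
    (h : ∀ κ, Trio (c κ) (a κ) (b κ) (l κ)) (u : ℕ → ℕ) (hu : ∀ κ, u κ < (c κ).join (l κ))
    (hf : ∀ t : ∀ κ, Digest κ, PolyFamily c l fun κ _ => List.ofFn (t κ)) :
    ∃ B : Polynomial ℕ, ∀ κ (t : Digest κ) ω,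
      size (P.ledger (solo P Δ κ (c κ) (b κ) (List.ofFn t) ω (u κ + 1)).1) ≤ B.eval κ := by
  set L : ∀ κ, Digest κ → Coins → ℕ := fun κ t ω =>
    size (P.ledger (solo P Δ κ (c κ) (b κ) (List.ofFn t) ω (u κ + 1)).1) with hL
  have hfam : ∀ t : ∀ κ, Digest κ, ∃ B : Polynomial ℕ, ∀ κ ω, L κ (t κ) ω ≤ B.eval κ := by
    intro t
    obtain ⟨B, hB⟩ := (hf t).exists_solo_le hP hΔ h
    exact ⟨B, fun κ ω => ((hB κ ω (u κ) (hu κ).le).2 (hu κ)).2⟩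
  have hbdd : ∀ κ (t : Digest κ), BddAbove (Set.range (L κ t)) := by
    intro κ t
    -- Only one `κ` matters here, so the polynomial may depend on it. Boundedness is needed for the
    -- supremum below to be an upper bound.
    obtain ⟨B, hB⟩ := hfam (Function.update (fun κ _ => false) κ t)
    refine ⟨B.eval κ, ?_⟩
    rintro _ ⟨ω, rfl⟩
    simpa using hB κ ω
  -- The family of worst transactions is itself admissible, and its polynomial bounds all others.
  choose t ht using fun κ => Finite.exists_max fun t : Digest κ => ⨆ ω, L κ t ω
  obtain ⟨B, hB⟩ := hfam t
  exact ⟨B, fun κ t' ω => (le_ciSup (hbdd κ t') ω).trans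
    ((ht κ t').trans (ciSup_le' fun ω => hB κ ω))⟩

end Polynomial

/-! ### Transactions that the other player is unlikely to guess -/

section Averaging

/-- Countably many coordinates make open sets of coins measurable for the product σ-algebra. -/
instance : Countable Coordinate := by
  let f : Coordinate → (List Bool × ℕ) ⊕ (ℕ × List Bool × ℕ) ⊕ (Option ℕ × ℕ)
    | .hash x k => .inl (x, k)
    | .sig i m k => .inr (.inl (i, m, k))
    | .tape o k => .inr (.inr (o, k))
  refine Function.Injective.countable (f := f) ?_
  rintro (_ | _ | _) (_ | _ | _) h <;> simp_all [f]

instance : IsProbabilityMeasure coinMeasure := by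
  unfold coinMeasure
  infer_instance

theorem measurableSet_mem_of_eventually_eq {f : Coins → List Tx}
    (hf : ∀ ω, ∀ᶠ ω' in 𝓝 ω, f ω' = f ω) (x : Tx) : MeasurableSet {ω | x ∈ f ω} := by
  refine IsOpen.measurableSet (isOpen_iff_mem_nhds.2 fun ω hω => ?_)
  filter_upwards [hf ω] with ω' h
  exact h ▸ hω

/-- A list of bounded length contains few strings in the mean. -/
theorem sum_measureReal_mem_le {T : Type*} [Fintype T] {enc : T → Tx}
    (henc : Function.Injective enc) {f : Coins → List Tx}
    (hf : ∀ ω, ∀ᶠ ω' in 𝓝 ω, f ω' = f ω) {M : ℕ} (hM : ∀ ω, (f ω).length ≤ M) :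
    ∑ x, coinMeasure.real {ω | enc x ∈ f ω} ≤ M := by
  classical
  have hm : ∀ x, MeasurableSet {ω | enc x ∈ f ω} := fun x =>
    measurableSet_mem_of_eventually_eq hf _
  have hint : ∀ x, Integrable ({ω | enc x ∈ f ω}.indicator fun _ => (1 : ℝ)) coinMeasure :=
    fun x => (integrable_const 1).indicator (hm x)
  calc ∑ x, coinMeasure.real {ω | enc x ∈ f ω}
      = ∑ x, ∫ ω, {ω | enc x ∈ f ω}.indicator (fun _ => (1 : ℝ)) ω ∂coinMeasure := by
        refine Finset.sum_congr rfl fun x _ => ?_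
        rw [integral_indicator_const _ (hm x)]
        simp
    _ = ∫ ω, ∑ x, {ω | enc x ∈ f ω}.indicator (fun _ => (1 : ℝ)) ω ∂coinMeasure :=
        (integral_finsetSum _ fun x _ => hint x).symm
    _ ≤ ∫ _, (M : ℝ) ∂coinMeasure := by
        refine integral_mono (integrable_finsetSum _ fun x _ => hint x) (integrable_const _)
          fun ω => ?_
        simp only [Set.indicator_apply, Set.mem_ofPred_eq, Finset.sum_boole]
        refine Nat.cast_le.2 (le_trans ?_ (hM ω))
        -- Distinct `x` give distinct entries of the list `f ω`, so its length bounds their number.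
        rw [← Finset.card_image_of_injective _ henc]
        refine (Finset.card_le_card (t := (f ω).toFinset) ?_).trans (List.toFinset_card_le _)
        intro y hy
        obtain ⟨x, hx, rfl⟩ := Finset.mem_image.1 hy
        exact List.mem_toFinset.2 (Finset.mem_filter.1 hx).2
    _ = M := by simp

/-- Some pair of strings is such that neither is likely to be found by somebody who knows the other
one only. -/
theorem exists_measureReal_mem_add_le {T : Type*} [Fintype T] [Nonempty T] {enc : T → Tx}
    (henc : Function.Injective enc) {f g : T → Coins → List Tx}
    (hf : ∀ x ω, ∀ᶠ ω' in 𝓝 ω, f x ω' = f x ω) (hg : ∀ x ω, ∀ᶠ ω' in 𝓝 ω, g x ω' = g x ω)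
    {M N : ℕ} (hM : ∀ x ω, (f x ω).length ≤ M) (hN : ∀ x ω, (g x ω).length ≤ N) :
    ∃ x y, coinMeasure.real {ω | enc y ∈ f x ω} + coinMeasure.real {ω | enc x ∈ g y ω} ≤
      (M + N) / Fintype.card T := by
  have hT : (Fintype.card T : ℝ) ≠ 0 := Nat.cast_ne_zero.2 Fintype.card_ne_zero
  obtain ⟨⟨x, y⟩, -, h⟩ := Finset.exists_le_of_sum_le (s := (Finset.univ : Finset (T × T)))
    (f := fun z => coinMeasure.real {ω | enc z.2 ∈ f z.1 ω} +
      coinMeasure.real {ω | enc z.1 ∈ g z.2 ω})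
    (g := fun _ => ((M : ℝ) + N) / Fintype.card T) Finset.univ_nonempty (by
      have h₁ : ∑ z : T × T, coinMeasure.real {ω | enc z.2 ∈ f z.1 ω} ≤ Fintype.card T * M := by
        rw [Fintype.sum_prod_type]
        refine (Finset.sum_le_card_nsmul _ _ (M : ℝ)
          fun x _ => sum_measureReal_mem_le henc (hf x) (hM x)).trans ?_
        simp
      have h₂ : ∑ z : T × T, coinMeasure.real {ω | enc z.1 ∈ g z.2 ω} ≤ Fintype.card T * N := by
        rw [Fintype.sum_prod_type_right]
        refine (Finset.sum_le_card_nsmul _ _ (N : ℝ)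
          fun x _ => sum_measureReal_mem_le henc (hg x) (hN x)).trans ?_
        simp
      rw [Finset.sum_add_distrib]
      refine (add_le_add h₁ h₂).trans (le_of_eq ?_)
      simp only [Finset.sum_const, Finset.card_univ, Fintype.card_prod, nsmul_eq_mul,
        Nat.cast_mul]
      field_simp)
  exact ⟨x, y, h⟩

end Averaging

/-! ### The population of the attack -/

/-- A fraction `p` of the mining power and `q` of the stake are given to one player, the rest to
another one; both hold a resource. -/
structure IsSharing (p q : ℝ) : Prop where
  power_mem : p ∈ Set.Icc (0 : ℝ) 1
  stake_mem : q ∈ Set.Icc (0 : ℝ) 1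
  pos : 0 < q ∨ 0 < p
  lt_one : q < 1 ∨ p < 1

namespace IsSharing

variable {p q : ℝ} (h : IsSharing p q)

/-- A total mining power that can be divided in the proportion `p : 1 - p`. -/
noncomputable def total (p : ℝ) : ℝ := p⁻¹ + (1 - p)⁻¹ + 1

include h in
theorem one_le_total : 1 ≤ total p := by
  have h₁ := inv_nonneg.2 h.power_mem.1
  have h₂ := inv_nonneg.2 (sub_nonneg.2 h.power_mem.2)
  rw [total]
  linarith

include h in
-- The summand `p⁻¹` of `total p` alone contributes `1` to the product when `p ≠ 0`.
theorem mul_total_eq_zero_or : p * total p = 0 ∨ 1 ≤ p * total p := by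
  rcases h.power_mem.1.eq_or_lt with hp | hp
  · simp [← hp]
  · right
    have h₂ := inv_nonneg.2 (sub_nonneg.2 h.power_mem.2)
    rw [total, mul_add, mul_add, mul_inv_cancel₀ hp.ne']
    nlinarith [mul_nonneg hp.le h₂]

include h in
theorem symm : IsSharing (1 - p) (1 - q) where
  power_mem := by have := h.power_mem; constructor <;> linarith [this.1, this.2]
  stake_mem := by have := h.stake_mem; constructor <;> linarith [this.1, this.2]
  pos := by simpa using h.lt_one
  lt_one := by simpa using h.pos

theorem total_symm : total (1 - p) = total p := by
  rw [total, total, sub_sub_cancel, add_comm (1 - p)⁻¹]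

/-- Two players share the stake, and the power before slot `R`, in which a third player comes
online and takes over the power. -/
noncomputable def config {R : ℕ} (hR : 0 < R) : Config where
  n := 3
  -- A player that joins late holds no stake and must therefore mine. Giving it all the power keeps
  -- the total constant, so that every `γ ≥ 1` is respected.
  power i r := if r < R then ![p * total p, (1 - p) * total p, 0] i else ![0, 0, total p] i
  stake := ![q, 1 - q, 0]
  join := ![0, 0, R]
  power_eq_zero_or i r := by
    have h₁ := h.symm.mul_total_eq_zero_or
    rw [total_symm] at h₁
    split_ifs <;> fin_cases i <;> simp
    · simpa using h.mul_total_eq_zero_or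
    · simpa using h₁
    · exact .inr h.one_le_total
  power_offline i r hr := by
    fin_cases i <;> simp_all
  stake_nonneg i := by
    fin_cases i <;> simp [h.stake_mem.1, h.stake_mem.2]
  stake_online i hi := by
    fin_cases i <;> simp_all
  has_resource i := by
    have h₁ := h.one_le_total
    fin_cases i
    · simpa [hR, show 0 < total p by linarith] using h.pos
    · simpa [hR, show 0 < total p by linarith] using h.lt_one
    · simpa using show 0 < total p by linarith
  total_power_pos r := by
    have h₁ := h.one_le_total
    split_ifs
    · simp [Fin.sum_univ_three]
      nlinarith
    · simp [Fin.sum_univ_three]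
      linarith
  total_stake_pos := by simp [Fin.sum_univ_three]

variable {R : ℕ} (hR : 0 < R)

theorem totalPower_config (r : ℕ) : (h.config hR).totalPower r = total p := by
  change ∑ i : Fin 3, (if r < R then ![p * total p, (1 - p) * total p, 0] i
    else ![0, 0, total p] i) = total p
  split_ifs <;> simp [Fin.sum_univ_three]
  ring

theorem isRespecting_config {γ : ℝ} (hγ : 1 ≤ γ) : (h.config hR).IsRespecting γ := by
  intro r r'
  rw [totalPower_config, totalPower_config]
  exact le_mul_of_one_le_left (by linarith [h.one_le_total]) hγ

theorem trio_config : Trio (h.config hR) (0 : Fin 3) (1 : Fin 3) (2 : Fin 3) where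
  ne := show (0 : Fin 3) ≠ 1 by decide
  ne_left := show (0 : Fin 3) ≠ 2 by decide
  ne_right := show (1 : Fin 3) ≠ 2 by decide
  cover := show ∀ j : Fin 3, j = 0 ∨ j = 1 ∨ j = 2 by decide
  join_left := rfl
  join_right := rfl

theorem sum_stake_config : ∑ i, (h.config hR).stake i = 1 := by
  change ∑ i : Fin 3, ![q, 1 - q, 0] i = 1
  simp [Fin.sum_univ_three]

theorem controls_left {βw βs : ℝ} (hw : p ≤ βw) (hs : q ≤ βs) :
    (h.config hR).Controls {(0 : Fin 3)} βw βs := by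
  have h₁ := h.one_le_total
  have hp := h.power_mem.1
  refine ⟨fun r => ?_, ?_⟩
  · rw [totalPower_config]
    refine (Finset.sum_singleton (fun i => (h.config hR).power i r) _).trans_le ?_
    change (if r < R then p * total p else 0) ≤ _
    split_ifs <;> nlinarith
  · rw [sum_stake_config, mul_one]
    exact (Finset.sum_singleton (h.config hR).stake _).trans_le hs

theorem controls_right {βw βs : ℝ} (hw : 1 - p ≤ βw) (hs : 1 - q ≤ βs) :
    (h.config hR).Controls {(1 : Fin 3)} βw βs := by
  have h₁ := h.one_le_total
  have hp := h.power_mem.2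
  refine ⟨fun r => ?_, ?_⟩
  · rw [totalPower_config]
    refine (Finset.sum_singleton (fun i => (h.config hR).power i r) _).trans_le ?_
    change (if r < R then (1 - p) * total p else 0) ≤ _
    split_ifs <;> nlinarith
  · rw [sum_stake_config, mul_one]
    exact (Finset.sum_singleton (h.config hR).stake _).trans_le hs

end IsSharing

/-! ### Asymptotics and conclusion -/

theorem tendsto_eval_div_two_pow (B : Polynomial ℕ) :
    Tendsto (fun κ : ℕ => ((B.eval κ : ℕ) : ℝ) / 2 ^ κ) atTop (𝓝 0) := by
  induction B using Polynomial.induction_on' with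
  | add B C hB hC =>
    simpa [Polynomial.eval_add, add_div] using hB.add hC
  | monomial n a =>
    simpa [Polynomial.eval_monomial, mul_div_assoc] using
      (tendsto_pow_const_div_const_pow_of_one_lt n (one_lt_two (α := ℝ))).const_mul (a : ℝ)

theorem tendsto_zero_of_superpolynomialDecay {f : ℕ → ℝ}
    (hf : Asymptotics.SuperpolynomialDecay atTop (fun κ : ℕ => (κ : ℝ)) f) :
    Tendsto f atTop (𝓝 0) := by
  simpa using hf 0

/-- One party may corrupt one of two players that share the resources, and the other party may
corrupt the other one: this is not secure. -/
theorem IsSharing.not_secureAt {p q : ℝ} (h : IsSharing p q) {P : Protocol} {Δ : ℕ} (hΔ : 1 ≤ Δ)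
    {γ : ℝ} (hγ : 1 ≤ γ) (hP : P.PolyBounded Δ) {p₁ q₁ p₂ q₂ : ℝ} (hp₁ : p ≤ p₁) (hq₁ : q ≤ q₁)
    (hp₂ : 1 - p ≤ p₂) (hq₂ : 1 - q ≤ q₂) (h₁ : SecureAt P Δ γ p₁ q₁)
    (h₂ : SecureAt P Δ γ p₂ q₂) : False := by
  obtain ⟨u₁, h₁⟩ := h₁
  obtain ⟨u₂, h₂⟩ := h₂
  -- This slot lies strictly after both `u₁ + Δ` and `u₂ + Δ`, as persistence requires in either
  -- scenario.
  have hR : ∀ κ, 0 < u₁.eval κ + u₂.eval κ + Δ + 1 := fun κ => Nat.succ_pos _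
  let c : ℕ → Config := fun κ => h.config (hR κ)
  let a : ∀ κ, Fin (c κ).n := fun κ => (0 : Fin 3)
  let b : ∀ κ, Fin (c κ).n := fun κ => (1 : Fin 3)
  let l : ∀ κ, Fin (c κ).n := fun κ => (2 : Fin 3)
  have htrio : ∀ κ, Trio (c κ) (a κ) (b κ) (l κ) := fun κ => h.trio_config (hR κ)
  have hjoin : ∀ κ, (c κ).join (l κ) = u₁.eval κ + u₂.eval κ + Δ + 1 := fun κ => rfl
  have hpoly : ∀ tx : ∀ κ, Fin (c κ).n → Tx, (∀ κ j, (tx κ j).length ≤ κ) →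
      PolyFamily c l tx := by
    intro tx htx
    refine ⟨u₁ + u₂ + Polynomial.C (Δ + 5 + ⌈total p⌉₊) + Polynomial.X, fun κ => ?_⟩
    simp only [Polynomial.eval_add, Polynomial.eval_C, Polynomial.eval_X, hjoin]
    refine ⟨by omega, show 3 ≤ _ by omega, fun r => ?_, fun j => ?_⟩
    · rw [h.totalPower_config]
      exact (Nat.le_ceil _).trans (Nat.cast_le.2 (by omega))
    · have := htx κ j
      omega
  have hconst : ∀ t : ∀ κ, Digest κ, PolyFamily c l fun κ _ => List.ofFn (t κ) := fun t =>
    hpoly _ fun κ j => (List.length_ofFn).le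
  obtain ⟨Ba, hBa⟩ := exists_ledger_solo_le hP hΔ (fun κ => (htrio κ).symm) (fun κ => u₂.eval κ)
    (fun κ => by rw [hjoin]; omega) hconst
  obtain ⟨Bb, hBb⟩ := exists_ledger_solo_le hP hΔ htrio (fun κ => u₁.eval κ)
    (fun κ => by rw [hjoin]; omega) hconst
  let La : ∀ κ, Digest κ → Coins → List Tx := fun κ t ω =>
    P.ledger (solo P Δ κ (c κ) (a κ) (List.ofFn t) ω (u₂.eval κ + 1)).1
  let Lb : ∀ κ, Digest κ → Coins → List Tx := fun κ t ω =>
    P.ledger (solo P Δ κ (c κ) (b κ) (List.ofFn t) ω (u₁.eval κ + 1)).1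
  have hbad : ∀ κ, ∃ x y : Digest κ, coinMeasure.real {ω | List.ofFn y ∈ La κ x ω} +
      coinMeasure.real {ω | List.ofFn x ∈ Lb κ y ω} ≤
        ((Ba.eval κ : ℕ) + (Bb.eval κ : ℕ) : ℝ) / Fintype.card (Digest κ) := fun κ =>
    exists_measureReal_mem_add_le List.ofFn_injective
      (fun x ω => (eventually_solo_eq P Δ κ (c κ) (a κ) (List.ofFn x) ω _).mono
        fun ω' hω => congrArg (fun z => P.ledger z.1) hω)
      (fun y ω => (eventually_solo_eq P Δ κ (c κ) (b κ) (List.ofFn y) ω _).mono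
        fun ω' hω => congrArg (fun z => P.ledger z.1) hω)
      (fun x ω => (length_le_size _).trans (hBa κ x ω))
      (fun y ω => (length_le_size _).trans (hBb κ y ω))
  choose x y hxy using hbad
  let tx : ∀ κ, Fin (c κ).n → Tx := fun κ =>
    (![List.ofFn (x κ), List.ofFn (y κ), []] : Fin 3 → Tx)
  have htx : PolyFamily c l tx := hpoly tx fun κ j => by
    change Fin 3 at j
    fin_cases j <;> simp [tx]
  have hε₁ := tendsto_zero_of_superpolynomialDecay
    (h₁ (fun κ => splitAttack P Δ κ (c κ) (a κ) (l κ) (tx κ)) (htx.splitAttack hP hΔ htrio)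
      (fun κ => h.isRespecting_config (hR κ) hγ) fun κ => h.controls_left (hR κ) hp₁ hq₁)
  have hε₂ := tendsto_zero_of_superpolynomialDecay
    (h₂ (fun κ => splitAttack P Δ κ (c κ) (b κ) (l κ) (tx κ))
      (htx.splitAttack hP hΔ fun κ => (htrio κ).symm)
      (fun κ => h.isRespecting_config (hR κ) hγ) fun κ => h.controls_right (hR κ) hp₂ hq₂)
  have hε₃ := tendsto_eval_div_two_pow (Ba + Bb)
  have hsum := (hε₁.add hε₂).add hε₃
  simp only [add_zero] at hsum
  obtain ⟨κ, hκ⟩ := (hsum.eventually_lt_const one_pos).exists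
  have hcard : (Fintype.card (Digest κ) : ℝ) = 2 ^ κ := by simp
  have hκ' := hxy κ
  rw [hcard, ← Nat.cast_add, ← Polynomial.eval_add] at hκ'
  -- Either an execution fails or a solitary player has the foreign transaction; the four
  -- probabilities add up to less than `1`. A union bound needs no measurability of the failure
  -- events.
  have hcover : (Set.univ : Set Coins) ⊆
      ({ω | ¬ Robust P Δ (splitAttack P Δ κ (c κ) (a κ) (l κ) (tx κ)) ω (u₁.eval κ)} ∪
        {ω | ¬ Robust P Δ (splitAttack P Δ κ (c κ) (b κ) (l κ) (tx κ)) ω (u₂.eval κ)}) ∪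
      ({ω | List.ofFn (y κ) ∈ La κ (x κ) ω} ∪ {ω | List.ofFn (x κ) ∈ Lb κ (y κ) ω}) := by
    intro ω _
    by_cases hr₁ : Robust P Δ (splitAttack P Δ κ (c κ) (a κ) (l κ) (tx κ)) ω (u₁.eval κ)
    · by_cases hr₂ : Robust P Δ (splitAttack P Δ κ (c κ) (b κ) (l κ) (tx κ)) ω (u₂.eval κ)
      · obtain ⟨hb, hb'⟩ := (htrio κ).ledger_of_robust hΔ (by rw [hjoin]; omega) hr₁
        obtain ⟨ha, ha'⟩ := (htrio κ).symm.ledger_of_robust hΔ (by rw [hjoin]; omega) hr₂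
        -- Both ledgers are prefixes of literally the same ledger of `l`.
        rcases List.prefix_or_prefix_of_prefix hb' ha' with hpre | hpre
        · exact .inr (.inl (hpre.subset hb))
        · exact .inr (.inr (hpre.subset ha))
      · exact .inl (.inr hr₂)
    · exact .inl (.inl hr₁)
  have hone := measureReal_mono (μ := coinMeasure) hcover
  rw [probReal_univ] at hone
  have := (hone.trans (measureReal_union_le _ _)).trans
    (add_le_add (measureReal_union_le _ _) (measureReal_union_le _ _))
  linarith

end HybridLedger

theorem mainTheorem2 (P : HybridLedger.Protocol) (Δ : ℕ) (hΔ : 1 ≤ Δ) (γ : ℝ) (hγ : 1 ≤ γ)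
    (hP : P.PolyBounded Δ) (p₁ q₁ p₂ q₂ : ℝ) (hp : 1 ≤ p₁ + p₂) (hq : 1 ≤ q₁ + q₂) :
    ¬ ((p₁, q₁) ∈ HybridLedger.securityRegion P Δ γ ∧
        (p₂, q₂) ∈ HybridLedger.securityRegion P Δ γ) := by
  rintro ⟨⟨⟨hp₁, hq₁⟩, h₁⟩, ⟨⟨hp₂, hq₂⟩, h₂⟩⟩
  simp only [Set.mem_Icc] at hp₁ hq₁ hp₂ hq₂ h₁ h₂
  have half : HybridLedger.IsSharing (1 / 2) (1 / 2) := by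
    constructor <;> norm_num
  -- If one share were empty, its player would have no resource at all. The other point then has
  -- both coordinates at least `1`, and an even split attacks that point alone.
  by_cases hzero : p₁ = 0 ∧ q₁ = 0
  · exact half.not_secureAt hΔ hγ hP (by linarith) (by linarith) (by linarith) (by linarith) h₂ h₂
  by_cases hone : p₁ = 1 ∧ q₁ = 1
  · exact half.not_secureAt hΔ hγ hP (by linarith) (by linarith) (by linarith) (by linarith) h₁ h₁
  have hshare : HybridLedger.IsSharing p₁ q₁ := by
    refine ⟨hp₁, hq₁, ?_, ?_⟩
    · by_contra! hle
      exact hzero ⟨le_antisymm hle.2 hp₁.1, le_antisymm hle.1 hq₁.1⟩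
    · by_contra! hle
      exact hone ⟨le_antisymm hp₁.2 hle.2, le_antisymm hq₁.2 hle.1⟩
  exact hshare.not_secureAt hΔ hγ hP le_rfl le_rfl (by linarith) (by linarith) h₁ h₂
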